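/- Let $k$ be a field, $R=k[x,y,z,u]$ the polynomial ring in four variables with the standard grading, and $\mathfrak m=(x,y,z,u)$. For an ideal $I$ of $R$ let $\operatorname{astab}(I)$ be the least integer $a\ge 1$ such that $\operatorname{Ass}(R/I^n)=\operatorname{Ass}(R/I^a)$ for all $n\ge a$, and let $\operatorname{dstab}(I)$ be the least integer $d\ge 1$ such that $\operatorname{depth}(R/I^n)=\operatorname{depth}(R/I^d)$ for all $n\ge d$, where $\operatorname{depth}(M)$ is the supremum of the lengths of $M$-regular sequences contained in $\mathfrak m$. Then for every integer $c\ge 0$ there are homogeneous ideals $I$ and $J$ of $R$ such that (i) $\operatorname{astab}(I)-\operatorname{dstab}(I)\ge c$, and (ii) $\operatorname{dstab}(J)-\operatorname{astab}(J)\ge c$. Explicitly, for every $c\ge 1$ the ideal $I=(x^{c+1}z^{c},\,u^{2c-1}yz,\,u^{2c+1})$ has $\operatorname{astab}(I)=c+1$ and $\operatorname{dstab}(I)=1$; and for every $c\ge 2$ the ideal $J=(x^{c}y^{c-1},\,x^{c-1}y^{c-1}z,\,z^{c}u^{c})$ has $\operatorname{astab}(J)=1$ and $\operatorname{dstab}(J)=c+1$.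 -/

import Mathlib

namespace PowerStability

open MvPolynomial

/-- The depth of an `R`-module `M` with respect to an ideal `m`: the supremum of the lengths of
the `M`-regular sequences consisting of elements of `m`. -/
noncomputable def depth {R : Type*} [CommRing R] (m : Ideal R) (M : Type*) [AddCommGroup M]
    [Module R M] : ℕ∞ :=
  ⨆ rs ∈ {rs : List R | (∀ r ∈ rs, r ∈ m) ∧ RingTheory.Sequence.IsRegular M rs},
    (rs.length : ℕ∞)

/-- `a` is the index of Ass-stability `astab(I)`: the least integer `a ≥ 1` such that
`Ass(R/I^n) = Ass(R/I^a)` for all `n ≥ a`. -/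
def IsAstab {R : Type*} [CommRing R] (I : Ideal R) (a : ℕ) : Prop :=
  IsLeast {a : ℕ | 1 ≤ a ∧
    ∀ n, a ≤ n → associatedPrimes R (R ⧸ I ^ n) = associatedPrimes R (R ⧸ I ^ a)} a

/-- `d` is the index of depth stability `dstab(I)` with respect to `m`: the least integer `d ≥ 1`
such that `depth(R/I^n) = depth(R/I^d)` for all `n ≥ d`. -/
def IsDstab {R : Type*} [CommRing R] (m I : Ideal R) (d : ℕ) : Prop :=
  IsLeast {d : ℕ | 1 ≤ d ∧ ∀ n, d ≤ n → depth m (R ⧸ I ^ n) = depth m (R ⧸ I ^ d)} d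

/-- The ideal `(x^(c+1) z^c, u^(2c-1) y z, u^(2c+1))` of `k[x,y,z,u]` (used for `c ≥ 1`);
the variables `x, y, z, u` are `X 0, X 1, X 2, X 3`. -/
noncomputable def idealI (k : Type*) [Field k] (c : ℕ) : Ideal (MvPolynomial (Fin 4) k) :=
  Ideal.span {X 0 ^ (c + 1) * X 2 ^ c, X 3 ^ (2 * c - 1) * X 1 * X 2, X 3 ^ (2 * c + 1)}

/-- The ideal `(x^c y^(c-1), x^(c-1) y^(c-1) z, z^c u^c)` of `k[x,y,z,u]` (used for `c ≥ 2`);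
the variables `x, y, z, u` are `X 0, X 1, X 2, X 3`. -/
noncomputable def idealJ (k : Type*) [Field k] (c : ℕ) : Ideal (MvPolynomial (Fin 4) k) :=
  Ideal.span {X 0 ^ c * X 1 ^ (c - 1), X 0 ^ (c - 1) * X 1 ^ (c - 1) * X 2, X 2 ^ c * X 3 ^ c}

end PowerStability

attribute [local instance] MvPolynomial.gradedAlgebra

/-! Powers of a monomial ideal are governed by exponent vectors. The associated primes are generated
by sets of variables, each realised as the colon by a single monomial (`mem_associatedPrimes_iff`),
so astability becomes a question about integer inequalities. Membership in the `n`-th power is first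
simplified by eliminating one or two of the three generator multiplicities (`memI_iff`, `memJ_iff`,
`memK_iff`).

For `I`, no power has an associated prime containing `x, y, z`, so `x + y + z + u` is always
regular. On the other hand `(x, y, u)` is associated to every power and together with this form
gives the maximal ideal. Hence the depth is constantly 1 (`depth_idealI_pow`). The prime `(x, z,
u)`, however, appears only at the power `c + 1`, after which nothing changes
(`hasColonVars_memI_iff`, `lt_of_memI_xz`).

For `J`, every power has exactly the associated primes `(x, z)`, `(x, u)`, `(y, z)`, `(y, u)`
(`hasColonVars_memJ_iff`), so `x - y` is always regular. Modulo it, `J` becomes `K = (x^(2c-1),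
x^(2c-2) z, z^c u^c)`. Up to `n = c` the form `z - u` is regular modulo `K^n`, so the depth is at
least 2. From `n = c + 1` on, a monomial outside `K^n` is multiplied into it by `x`, `z` and `u`,
and the depth drops to 1 (`lt_of_memK_xzu`, `depth_idealJ_pow`). -/

namespace PowerStability

open MvPolynomial RingTheory.Sequence
open scoped Pointwise

/-! ### Elementary bounds for depth. -/

section Depth

variable {R M : Type*} [CommRing R] [AddCommGroup M] [Module R M]

theorem length_le_depth {m : Ideal R} {rs : List R} (hm : ∀ r ∈ rs, r ∈ m)
    (hrs : IsRegular M rs) : (rs.length : ℕ∞) ≤ depth m M :=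
  le_iSup₂_of_le (f := fun (rs : List R)
    (_ : rs ∈ {rs : List R | (∀ r ∈ rs, r ∈ m) ∧ IsRegular M rs}) => (rs.length : ℕ∞))
    rs ⟨hm, hrs⟩ le_rfl

/-- If `f` is `M`-regular and some nonzero element of `M / fM` is killed by `m`, then every
`M`-regular sequence in `m` has length at most one. -/
theorem depth_le_one_of_socle {m : Ideal R} {f : R} (hf : IsSMulRegular M f) {v : M}
    (hv : ∀ w : M, f • w ≠ v) (hm : ∀ r ∈ m, ∃ w : M, r • v = f • w) : depth m M ≤ 1 := by
  refine iSup₂_le ?_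
  rintro rs ⟨hrs, hreg⟩
  match rs, hrs, hreg with
  | [], _, _ => simp
  | [_], _, _ => simp
  | g :: h :: t, hrs, hreg =>
    exfalso
    have hw := hreg.toIsWeaklyRegular
    rw [isWeaklyRegular_cons_iff, isWeaklyRegular_cons_iff] at hw
    obtain ⟨hg, hh, -⟩ := hw
    obtain ⟨a, ha⟩ := hm g (hrs g (by simp))
    obtain ⟨b, hb⟩ := hm h (hrs h (by simp))
    -- With `g v = f a` and `h v = f b`, cancelling `f` gives `h a = g b`. Regularity of `h` modulo
    -- `g` then yields `a = g w`, and cancelling `g` gives `v = f w`, a contradiction.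
    have hab : h • a = g • b := by
      apply hf
      change f • h • a = f • g • b
      rw [smul_comm f h, ← ha, smul_comm f g, ← hb, smul_comm h g]
    have hza : (Submodule.mkQ (g • (⊤ : Submodule R M))) a = 0 := by
      apply hh
      change h • (Submodule.mkQ (g • (⊤ : Submodule R M))) a = h • (0 : QuotSMulTop g M)
      rw [smul_zero, ← map_smul, hab, Submodule.mkQ_apply, Submodule.Quotient.mk_eq_zero]
      exact Submodule.smul_mem_pointwise_smul _ _ _ trivial
    rw [Submodule.mkQ_apply, Submodule.Quotient.mk_eq_zero,
      Submodule.mem_smul_pointwise_iff_exists] at hza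
    obtain ⟨w, -, hw⟩ := hza
    refine hv w (hg ?_)
    change g • f • w = g • v
    rw [ha, ← hw, smul_comm]

/-- An associated prime `P` such that `P + (f)` is all of `m`, for a regular `f`, bounds the
depth by one. -/
theorem depth_le_one_of_mem_associatedPrimes [IsNoetherianRing R] [Module.Finite R M]
    {m P : Ideal R} (hm : m ≠ ⊤) {f : R} (hf : IsSMulRegular M f)
    (hP : P ∈ associatedPrimes R M) (hPm : P ⊔ Ideal.span {f} = m) : depth m M ≤ 1 := by
  rw [AssociatedPrimes.mem_iff, isAssociatedPrime_iff] at hP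
  obtain ⟨-, x, hx⟩ := hP
  have hPx : ∀ r, r ∈ P ↔ r • x = 0 := fun r => by
    rw [hx, Submodule.mem_colon_singleton, Submodule.mem_bot]
  -- `N` is the submodule killed by `P`. An element of `N` outside `f M` is killed by `m = P + (f)`
  -- modulo `f`, so the socle criterion applies.
  let N : Submodule R M :=
    { carrier := {v | ∀ r ∈ P, r • v = 0}
      add_mem' := fun {a b} ha hb r hr => by rw [smul_add, ha r hr, hb r hr, add_zero]
      zero_mem' := fun r _ => smul_zero r
      smul_mem' := fun s v hv r hr => by rw [smul_comm, hv r hr, smul_zero] }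
  by_cases hN : ∃ v ∈ N, ∀ w : M, f • w ≠ v
  · obtain ⟨v, hvN, hv⟩ := hN
    refine depth_le_one_of_socle hf hv fun r hr => ?_
    rw [← hPm, Submodule.mem_sup] at hr
    obtain ⟨p, hp, q, hq, rfl⟩ := hr
    obtain ⟨s, rfl⟩ := Ideal.mem_span_singleton'.1 hq
    exact ⟨s • v, by rw [add_smul, hvN p hp, zero_add, mul_comm, mul_smul]⟩
  · exfalso
    push Not at hN
    -- If `N ⊆ f M`, regularity of `f` gives `N = f N`. By Nakayama some element of `1 + (f)` kills
    -- `N`, hence kills `x` and lies in `P`, which forces `P + (f)` to be the unit ideal.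
    have hle : N ≤ Ideal.span {f} • N := by
      intro v hv
      obtain ⟨w, rfl⟩ := hN v hv
      refine Submodule.smul_mem_smul (Ideal.mem_span_singleton_self f) fun r hr => ?_
      apply hf
      change f • r • w = f • (0 : M)
      rw [smul_comm, hv r hr, smul_zero]
    obtain ⟨r, hr1, hr⟩ := Submodule.exists_sub_one_mem_and_smul_eq_zero_of_fg_of_le_smul
      (Ideal.span {f}) N (IsNoetherian.noetherian N) hle
    have hrP : r ∈ P := (hPx r).2 (hr x fun s hs => (hPx s).1 hs)
    apply hm
    rw [Ideal.eq_top_iff_one, ← hPm]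
    have := (P ⊔ Ideal.span {f}).sub_mem (Ideal.mem_sup_left hrP) (Ideal.mem_sup_right hr1)
    simpa using this

theorem isRegular_quotient_of_isWeaklyRegular {m U : Ideal R} (hm : m ≠ ⊤) (hU : U ≤ m)
    {rs : List R} (hrs : ∀ r ∈ rs, r ∈ m) (h : IsWeaklyRegular (R ⧸ U) rs) :
    IsRegular (R ⧸ U) rs := by
  refine ⟨h, fun htop => hm ?_⟩
  have hle : (Ideal.ofList rs • ⊤ : Submodule R (R ⧸ U)) ≤ Submodule.map U.mkQ m := by
    rw [Submodule.smul_le]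
    intro r hr x _
    obtain ⟨y, rfl⟩ := Submodule.mkQ_surjective U x
    refine ⟨r * y, m.mul_mem_right y ?_, by rw [← smul_eq_mul, map_smul]⟩
    exact (Ideal.span_le.2 fun a ha => hrs a ha : Ideal.ofList rs ≤ m) hr
  obtain ⟨a, ha, h1⟩ := hle (htop ▸ Submodule.mem_top : Submodule.mkQ U 1 ∈ _)
  have h2 : a - 1 ∈ U := (Submodule.Quotient.eq U).1 h1
  rw [Ideal.eq_top_iff_one]
  simpa using m.sub_mem ha (hU h2)

theorem isSMulRegular_quotient_iff {U : Ideal R} {f : R} :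
    IsSMulRegular (R ⧸ U) f ↔ ∀ g, f * g ∈ U → g ∈ U := by
  rw [isSMulRegular_iff_right_eq_zero_of_smul]
  constructor
  · intro h g hg
    have := h (Submodule.Quotient.mk g) (by
      rw [← Submodule.Quotient.mk_smul, Submodule.Quotient.mk_eq_zero]; exact hg)
    exact (Submodule.Quotient.mk_eq_zero U).1 this
  · intro h x hx
    obtain ⟨g, rfl⟩ := Submodule.mkQ_surjective U x
    rw [← map_smul] at hx
    exact (Submodule.Quotient.mk_eq_zero U).2 (h g ((Submodule.Quotient.mk_eq_zero U).1 hx))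

theorem mkQ_mem_smul_top_iff {U : Ideal R} {f p : R} :
    U.mkQ p ∈ f • (⊤ : Submodule R (R ⧸ U)) ↔ p ∈ U ⊔ Ideal.span {f} := by
  rw [Submodule.mem_smul_pointwise_iff_exists, Submodule.mem_sup]
  constructor
  · rintro ⟨w, -, hw⟩
    obtain ⟨q, rfl⟩ := Submodule.mkQ_surjective U w
    rw [← map_smul] at hw
    have h2 : f * q - p ∈ U := (Submodule.Quotient.eq U).1 hw
    exact ⟨p - f * q, by simpa using U.neg_mem h2, f * q,
      Ideal.mul_mem_right _ _ (Ideal.mem_span_singleton_self f), by ring⟩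
  · rintro ⟨a, ha, b, hb, rfl⟩
    obtain ⟨s, rfl⟩ := Ideal.mem_span_singleton'.1 hb
    refine ⟨U.mkQ s, trivial, ?_⟩
    rw [← map_smul]
    refine (Submodule.Quotient.eq U).2 ?_
    have : f • s - (a + s * f) = -a := by rw [smul_eq_mul]; ring
    rw [this]
    exact U.neg_mem ha

/-- The ideal-theoretic form of `depth_le_one_of_socle` for a cyclic module. -/
theorem depth_quotient_le_one_of_socle {m U : Ideal R} {f w : R}
    (hf : IsSMulRegular (R ⧸ U) f) (hw : w ∉ U ⊔ Ideal.span {f})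
    (hm : ∀ r ∈ m, r * w ∈ U ⊔ Ideal.span {f}) : depth m (R ⧸ U) ≤ 1 := by
  refine depth_le_one_of_socle hf (v := U.mkQ w) (fun y hy => hw ?_) fun r hr => ?_
  · obtain ⟨q, rfl⟩ := Submodule.mkQ_surjective U y
    exact mkQ_mem_smul_top_iff.1 (hy ▸ Submodule.smul_mem_pointwise_smul _ _ _ trivial)
  · have := mkQ_mem_smul_top_iff.2 (hm r hr)
    obtain ⟨y, -, hy⟩ := Submodule.mem_smul_pointwise_iff_exists _ _ _ |>.1 this
    exact ⟨y, by rw [hy, ← map_smul, smul_eq_mul]⟩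

theorem one_le_depth_quotient {m U : Ideal R} (hm : m ≠ ⊤) (hU : U ≤ m) {f : R} (hfm : f ∈ m)
    (hf : IsSMulRegular (R ⧸ U) f) : 1 ≤ depth m (R ⧸ U) := by
  have hmem : ∀ r ∈ [f], r ∈ m := by simpa using hfm
  simpa using length_le_depth hmem
    (isRegular_quotient_of_isWeaklyRegular hm hU hmem ((isWeaklyRegular_singleton_iff _ _).2 hf))

theorem two_le_depth_quotient {m U : Ideal R} (hm : m ≠ ⊤) (hU : U ≤ m) {f g : R} (hfm : f ∈ m)
    (hgm : g ∈ m) (hf : IsSMulRegular (R ⧸ U) f)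
    (hg : ∀ p, g * p ∈ U ⊔ Ideal.span {f} → p ∈ U ⊔ Ideal.span {f}) :
    2 ≤ depth m (R ⧸ U) := by
  have hmem : ∀ r ∈ [f, g], r ∈ m := by simp [hfm, hgm]
  refine length_le_depth hmem (isRegular_quotient_of_isWeaklyRegular hm hU hmem ?_)
  rw [isWeaklyRegular_cons_iff, isWeaklyRegular_singleton_iff]
  refine ⟨hf, isSMulRegular_iff_right_eq_zero_of_smul.2 fun x hx => ?_⟩
  obtain ⟨y, rfl⟩ := Submodule.mkQ_surjective _ x
  obtain ⟨p, rfl⟩ := Submodule.mkQ_surjective U y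
  rw [← map_smul, ← map_smul] at hx
  refine (Submodule.Quotient.mk_eq_zero _).2 (mkQ_mem_smul_top_iff.2 (hg p (mkQ_mem_smul_top_iff.1 ?_)))
  exact (Submodule.Quotient.mk_eq_zero _).1 hx

end Depth

/-! ### Associated primes of monomial ideals. -/

section MonomialIdeal

variable {σ k : Type*} [Field k]

/-- `U` is the monomial ideal spanned by the monomials with exponent in `T`, and `T` consists of
all exponents of monomials of `U`. -/
def IsMonomialWith (U : Ideal (MvPolynomial σ k)) (T : Set (σ →₀ ℕ)) : Prop :=
  ∀ p, p ∈ U ↔ ∀ w ∈ p.support, w ∈ T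

/-- The colon of the monomial ideal with exponents `T` by some monomial `w` is generated by the
variables in `S`. -/
def HasColonVars (T : Set (σ →₀ ℕ)) (S : Set σ) : Prop :=
  ∃ w : σ →₀ ℕ, (∀ i ∈ S, w + Finsupp.single i 1 ∈ T) ∧
    ∀ b : σ →₀ ℕ, (∀ i ∈ S, b i = 0) → w + b ∉ T

theorem IsMonomialWith.monomial_mem {U : Ideal (MvPolynomial σ k)} {T : Set (σ →₀ ℕ)}
    (hU : IsMonomialWith U T) (w : σ →₀ ℕ) : monomial w (1 : k) ∈ U ↔ w ∈ T := by
  classical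
  rw [hU]
  simp [support_monomial]

theorem IsMonomialWith.monomial_mul_mem {U : Ideal (MvPolynomial σ k)} {T : Set (σ →₀ ℕ)}
    (hU : IsMonomialWith U T) (b : σ →₀ ℕ) (f : MvPolynomial σ k) :
    monomial b (1 : k) * f ∈ U ↔ ∀ w ∈ f.support, b + w ∈ T := by
  classical
  rw [hU]
  constructor
  · intro h w hw
    apply h
    rw [mem_support_iff, coeff_monomial_mul, one_mul]
    exact mem_support_iff.1 hw
  · intro h w hw
    rw [mem_support_iff, coeff_monomial_mul'] at hw
    split_ifs at hw with hb
    · have := h (w - b) (mem_support_iff.2 (by simpa using hw))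
      rwa [add_tsub_cancel_of_le hb] at this
    · exact absurd rfl hw

theorem IsMonomialWith.add_mem {U : Ideal (MvPolynomial σ k)} {T : Set (σ →₀ ℕ)}
    (hU : IsMonomialWith U T) {w : σ →₀ ℕ} (hw : w ∈ T) (b : σ →₀ ℕ) : w + b ∈ T := by
  rw [← hU.monomial_mem] at hw ⊢
  have := U.mul_mem_right (monomial b 1) hw
  rwa [monomial_mul, one_mul] at this

theorem X_mem_span_X_image {S : Set σ} {i : σ} :
    (X i : MvPolynomial σ k) ∈ Ideal.span (X '' S) ↔ i ∈ S := by
  classical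
  rw [mem_ideal_span_X_image]
  simp [support_X, Finsupp.single_apply]

theorem span_X_image_injective :
    Function.Injective fun S : Set σ => (Ideal.span (X '' S) : Ideal (MvPolynomial σ k)) := by
  intro S S' h
  ext i
  rw [← X_mem_span_X_image (k := k), ← X_mem_span_X_image (k := k)]
  exact iff_of_eq (congrArg (X i ∈ ·) h)

/-- A substitution that fixes the variables modulo `P` induces the identity on the quotient. This
serves both for setting variables to zero and for `y ↦ x`. -/
theorem aeval_sub_self_mem {P : Ideal (MvPolynomial σ k)} {g : σ → MvPolynomial σ k}
    (hg : ∀ i, g i - X i ∈ P) (p : MvPolynomial σ k) : aeval g p - p ∈ P := by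
  have h : (Ideal.Quotient.mkₐ k P).comp (aeval g) = Ideal.Quotient.mkₐ k P :=
    algHom_ext fun i => by simpa using Ideal.Quotient.eq.2 (hg i)
  exact Ideal.Quotient.eq.1 (DFunLike.congr_fun h p)

theorem isPrime_span_X_image (S : Set σ) :
    (Ideal.span (X '' S) : Ideal (MvPolynomial σ k)).IsPrime := by
  classical
  let φ : MvPolynomial σ k →ₐ[k] MvPolynomial σ k := aeval fun i => if i ∈ S then 0 else X i
  have hker : Ideal.span (X '' S) = RingHom.ker φ := by
    apply le_antisymm
    · rw [Ideal.span_le]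
      rintro _ ⟨i, hi, rfl⟩
      simp [φ, RingHom.mem_ker, hi]
    · intro p hp
      rw [RingHom.mem_ker] at hp
      have := aeval_sub_self_mem (P := Ideal.span (X '' S))
        (g := fun i => if i ∈ S then 0 else X i) (fun i => by
          by_cases hi : i ∈ S
          · simpa [hi] using Ideal.subset_span (Set.mem_image_of_mem X hi)
          · simp [hi]) p
      rw [show aeval (fun i => if i ∈ S then 0 else X i) p = 0 from hp, zero_sub] at this
      simpa using this
  rw [hker]
  exact RingHom.ker_isPrime φ

theorem monomial_mem_of_isPrime {P : Ideal (MvPolynomial σ k)} (hP : P.IsPrime) {b : σ →₀ ℕ}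
    (hb : monomial b (1 : k) ∈ P) : ∃ i, X i ∈ P ∧ b i ≠ 0 := by
  rw [monomial_eq, map_one, one_mul, Finsupp.prod, hP.prod_mem_iff] at hb
  obtain ⟨i, hi, h⟩ := hb
  exact ⟨i, hP.mem_of_pow_mem _ h, Finsupp.mem_support_iff.1 hi⟩

/-- The support of any element of the annihilator of a single element modulo a monomial ideal is
again in the annihilator, if the latter is prime. -/
theorem monomial_mem_of_isPrime_of_colon [Finite σ] {U : Ideal (MvPolynomial σ k)}
    {T : Set (σ →₀ ℕ)} (hU : IsMonomialWith U T) {P : Ideal (MvPolynomial σ k)} (hP : P.IsPrime)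
    {f : MvPolynomial σ k} (hf : ∀ g, g ∈ P ↔ g * f ∈ U) :
    ∀ g ∈ P, ∀ b ∈ g.support, monomial b (1 : k) ∈ P := by
  classical
  obtain ⟨m⟩ : Nonempty (MonomialOrder σ) := by
    have : Fintype σ := Fintype.ofFinite σ
    let e : LinearOrder σ := LinearOrder.lift' (Fintype.equivFin σ) (Fintype.equivFin σ).injective
    exact ⟨MonomialOrder.lex⟩
  -- Double induction on the number of terms of `f`, then of `g`. If the leading monomial of `g`
  -- lies in `P`, it is removed from `g`; otherwise `f` is replaced by a polynomial with fewer terms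
  -- and the same colon.
  induction hn : f.support.card using Nat.strong_induction_on generalizing f with
  | _ n ihf =>
  subst hn
  intro g
  induction hn : g.support.card using Nat.strong_induction_on generalizing g with
  | _ n ihg =>
  subst hn
  intro hg
  rcases eq_or_ne g 0 with rfl | hg0
  · simp
  have hf0 : f ≠ 0 := by
    rintro rfl
    exact hP.ne_top ((Ideal.eq_top_iff_one _).2 ((hf 1).2 (by simp)))
  have hlead : m.degree g + m.degree f ∈ T := by
    refine (hU _).1 ((hf g).1 hg) _ ?_
    rw [mem_support_iff, m.coeff_mul_of_degree_add]
    exact mul_ne_zero (m.leadingCoeff_ne_zero_iff.2 hg0) (m.leadingCoeff_ne_zero_iff.2 hf0)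
  by_cases hmon : monomial (m.degree g) (1 : k) ∈ P
  · set t := monomial (m.degree g) (g.coeff (m.degree g)) with ht
    have htP : t ∈ P := by
      have := P.mul_mem_left (C (g.coeff (m.degree g))) hmon
      rwa [C_mul_monomial, mul_one] at this
    have hsupp : (g - t).support = g.support.erase (m.degree g) := by
      ext b
      simp only [mem_support_iff, coeff_sub, ht, coeff_monomial, Finset.mem_erase]
      by_cases hb : m.degree g = b
      · simp [hb]
      · simp [hb, Ne.symm hb]
    intro b hb
    rcases eq_or_ne b (m.degree g) with rfl | hne
    · exact hmon
    · refine ihg _ ?_ (g - t) rfl (P.sub_mem hg htP) b ?_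
      · rw [hsupp]
        exact Finset.card_erase_lt_of_mem (m.degree_mem_support hg0)
      · rw [hsupp]
        exact Finset.mem_erase.2 ⟨hne, hb⟩
  · set a := m.degree f
    set f' := f - monomial a (f.coeff a) with hf'
    have hsupp : f'.support = f.support.erase a := by
      ext b
      simp only [mem_support_iff, coeff_sub, hf', coeff_monomial, Finset.mem_erase]
      by_cases hb : a = b
      · simp [hb]
      · simp [hb, Ne.symm hb]
    have hcard : (monomial (m.degree g) (1 : k) * f').support.card < f.support.card := by
      have hsub : (monomial (m.degree g) (1 : k) * f').support ⊆
          f'.support.image (m.degree g + ·) := by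
        intro w hw
        rw [mem_support_iff, coeff_monomial_mul'] at hw
        split_ifs at hw with hb
        · exact Finset.mem_image.2 ⟨w - m.degree g, mem_support_iff.2 (by simpa using hw),
            add_tsub_cancel_of_le hb⟩
        · exact absurd rfl hw
      refine ((Finset.card_le_card hsub).trans Finset.card_image_le).trans_lt ?_
      rw [hsupp]
      exact Finset.card_erase_lt_of_mem (m.degree_mem_support hf0)
    -- The leading monomial of `g` times the leading term of `f` lies in `U`, so dropping that term
    -- is harmless. Multiplying `f` by a monomial outside the prime `P` leaves its colon equal to
    -- `P`.
    refine ihf _ hcard (f := monomial (m.degree g) (1 : k) * f') (fun h => ?_) rfl g hg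
    have hrem : h * (monomial (m.degree g) (1 : k) * monomial a (f.coeff a)) ∈ U := by
      refine U.mul_mem_left _ ?_
      have := U.mul_mem_left (C (f.coeff a)) ((hU.monomial_mem _).2 hlead)
      rw [C_mul_monomial, mul_one] at this
      rw [monomial_mul, one_mul]
      exact this
    rw [show h * (monomial (m.degree g) (1 : k) * f') = h * monomial (m.degree g) (1 : k) * f -
      h * (monomial (m.degree g) (1 : k) * monomial a (f.coeff a)) by rw [hf']; ring]
    rw [U.sub_mem_iff_left hrem, ← hf]
    exact ⟨fun hh => P.mul_mem_right _ hh, fun hh => (hP.mem_or_mem hh).resolve_right hmon⟩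

/-- An associated prime `P`, the colon of `f`, is generated by its variables, and these multiply
every term of `f` into `U`. If no term had colon `P`, each term would have a multiplier into `U`
free of the variables of `P`. The product of these multipliers sends `f` into `U`, so it lies in
`P`, which is impossible. -/
theorem mem_associatedPrimes_iff [Finite σ] {U : Ideal (MvPolynomial σ k)} {T : Set (σ →₀ ℕ)}
    (hU : IsMonomialWith U T) (P : Ideal (MvPolynomial σ k)) :
    P ∈ associatedPrimes (MvPolynomial σ k) (MvPolynomial σ k ⧸ U) ↔
      ∃ S, HasColonVars T S ∧ P = Ideal.span (X '' S) := by
  classical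
  have hcolon : ∀ f g : MvPolynomial σ k,
      g ∈ Submodule.colon ⊥ {(Submodule.Quotient.mk f : MvPolynomial σ k ⧸ U)} ↔ g * f ∈ U := by
    intro f g
    rw [Submodule.mem_colon_singleton, Submodule.mem_bot, ← Submodule.Quotient.mk_smul,
      Submodule.Quotient.mk_eq_zero, smul_eq_mul]
  rw [AssociatedPrimes.mem_iff, isAssociatedPrime_iff]
  constructor
  · rintro ⟨hP, x, hx⟩
    obtain ⟨f, rfl⟩ := Submodule.mkQ_surjective U x
    have hf : ∀ g, g ∈ P ↔ g * f ∈ U := fun g => by rw [hx]; exact hcolon f g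
    have hmon := monomial_mem_of_isPrime_of_colon hU hP hf
    have hPS : P = Ideal.span (X '' {i | X i ∈ P}) := by
      apply le_antisymm
      · intro g hg
        rw [mem_ideal_span_X_image]
        exact fun b hb => monomial_mem_of_isPrime hP (hmon g hg b hb)
      · rw [Ideal.span_le]
        rintro _ ⟨i, hi, rfl⟩
        exact hi
    refine ⟨{i | X i ∈ P}, ?_, hPS⟩
    by_contra hno
    have hall : ∀ w ∈ f.support, ∃ b : σ →₀ ℕ, (∀ i, X i ∈ P → b i = 0) ∧ w + b ∈ T := by
      intro w hw
      by_contra hcon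
      push Not at hcon
      refine hno ⟨w, fun i hi => ?_, hcon⟩
      rw [add_comm]
      exact (hU.monomial_mul_mem _ f).1 ((hf _).1 hi) w hw
    choose! b hb0 hb using hall
    have hmem : monomial (∑ w ∈ f.support, b w) (1 : k) ∈ P := by
      rw [hf, hU.monomial_mul_mem]
      intro w hw
      rw [← Finset.add_sum_erase _ _ hw, add_comm, ← add_assoc]
      exact hU.add_mem (hb w hw) _
    obtain ⟨i, hi, hne⟩ := monomial_mem_of_isPrime hP hmem
    apply hne
    rw [Finsupp.finsetSum_apply]
    exact Finset.sum_eq_zero fun w hw => hb0 w hw i hi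
  · rintro ⟨S, ⟨w, hS, hb⟩, rfl⟩
    refine ⟨isPrime_span_X_image S,
      Submodule.Quotient.mk (monomial w 1), ?_⟩
    ext g
    rw [hcolon, mem_ideal_span_X_image, mul_comm, hU.monomial_mul_mem]
    refine forall₂_congr fun b _ => ⟨?_, ?_⟩
    · rintro ⟨i, hi, hne⟩
      have := hU.add_mem (hS i hi) (b - Finsupp.single i 1)
      rwa [add_assoc, add_tsub_cancel_of_le] at this
      rw [Finsupp.single_le_iff]
      omega
    · intro h
      by_contra hcon
      push Not at hcon
      exact hb b hcon h

theorem isSMulRegular_of_forall_notMem [Finite σ] {U : Ideal (MvPolynomial σ k)}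
    {T : Set (σ →₀ ℕ)} (hU : IsMonomialWith U T) {f : MvPolynomial σ k}
    (hf : ∀ S, HasColonVars T S → f ∉ Ideal.span (X '' S)) :
    IsSMulRegular (MvPolynomial σ k ⧸ U) f := by
  rw [isSMulRegular_iff_right_eq_zero_of_smul]
  intro x hx
  by_contra hne
  have : f ∈ {r : MvPolynomial σ k | ∃ x : MvPolynomial σ k ⧸ U, x ≠ 0 ∧ r • x = 0} :=
    ⟨x, hne, hx⟩
  rw [← biUnion_associatedPrimes_eq_zero_divisors, Set.mem_iUnion₂] at this
  obtain ⟨P, hP, hfP⟩ := this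
  obtain ⟨S, hS, rfl⟩ := (mem_associatedPrimes_iff hU P).1 hP
  exact hf S hS hfP

theorem associatedPrimes_eq_iff [Finite σ] {U V : Ideal (MvPolynomial σ k)}
    {T T' : Set (σ →₀ ℕ)} (hU : IsMonomialWith U T) (hV : IsMonomialWith V T') :
    associatedPrimes (MvPolynomial σ k) (MvPolynomial σ k ⧸ U) =
      associatedPrimes (MvPolynomial σ k) (MvPolynomial σ k ⧸ V) ↔
      ∀ S, HasColonVars T S ↔ HasColonVars T' S := by
  have key : ∀ {W : Ideal (MvPolynomial σ k)} {Y : Set (σ →₀ ℕ)}, IsMonomialWith W Y → ∀ S,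
      HasColonVars Y S ↔ Ideal.span (X '' S) ∈
        associatedPrimes (MvPolynomial σ k) (MvPolynomial σ k ⧸ W) := by
    intro W Y hW S
    rw [mem_associatedPrimes_iff hW]
    exact ⟨fun h => ⟨S, h, rfl⟩, fun ⟨S', h, e⟩ => span_X_image_injective e ▸ h⟩
  constructor
  · intro h S
    rw [key hU, key hV, h]
  · intro h
    ext P
    rw [mem_associatedPrimes_iff hU, mem_associatedPrimes_iff hV]
    simp only [h]

end MonomialIdeal

/-! ### Powers of an ideal with three monomial generators. -/

section Powers

variable {σ k : Type*} [Field k]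

theorem span_monomial_pow (a b e : σ →₀ ℕ) (n : ℕ) :
    Ideal.span {monomial a (1 : k), monomial b 1, monomial e 1} ^ n =
      Ideal.span ((fun w => monomial w (1 : k)) ''
        {w | ∃ i j l, i + j + l = n ∧ w = i • a + j • b + l • e}) := by
  induction n with
  | zero =>
    rw [pow_zero, Ideal.one_eq_top, eq_comm, Ideal.eq_top_iff_one]
    exact Ideal.subset_span ⟨0, ⟨0, 0, 0, rfl, by simp⟩, rfl⟩
  | succ n ih =>
    rw [pow_succ, ih, Ideal.span_mul_span']
    congr 1
    ext p
    simp only [Set.mem_mul, Set.mem_image, Set.mem_insert_iff, Set.mem_singleton_iff]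
    constructor
    · rintro ⟨_, ⟨_, ⟨i, j, l, hn, rfl⟩, rfl⟩, _, rfl | rfl | rfl, rfl⟩
      · exact ⟨_, ⟨i + 1, j, l, by omega, rfl⟩, by
          rw [monomial_mul, one_mul]; exact congrArg (monomial · (1 : k)) (by module)⟩
      · exact ⟨_, ⟨i, j + 1, l, by omega, rfl⟩, by
          rw [monomial_mul, one_mul]; exact congrArg (monomial · (1 : k)) (by module)⟩
      · exact ⟨_, ⟨i, j, l + 1, by omega, rfl⟩, by
          rw [monomial_mul, one_mul]; exact congrArg (monomial · (1 : k)) (by module)⟩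
    · rintro ⟨_, ⟨i, j, l, hn, rfl⟩, rfl⟩
      rcases i with _ | i
      · rcases j with _ | j
        · obtain rfl : l = n + 1 := by omega
          exact ⟨_, ⟨_, ⟨0, 0, n, by omega, rfl⟩, rfl⟩, _, Or.inr (Or.inr rfl), by
            rw [monomial_mul, one_mul]; exact congrArg (monomial · (1 : k)) (by module)⟩
        · exact ⟨_, ⟨_, ⟨0, j, l, by omega, rfl⟩, rfl⟩, _, Or.inr (Or.inl rfl), by
            rw [monomial_mul, one_mul]; exact congrArg (monomial · (1 : k)) (by module)⟩
      · exact ⟨_, ⟨_, ⟨i, j, l, by omega, rfl⟩, rfl⟩, _, Or.inl rfl, by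
          rw [monomial_mul, one_mul]; exact congrArg (monomial · (1 : k)) (by module)⟩

theorem isMonomialWith_span_pow (a b e : σ →₀ ℕ) (n : ℕ) :
    IsMonomialWith (Ideal.span {monomial a (1 : k), monomial b 1, monomial e 1} ^ n)
      {w | ∃ i j l, i + j + l = n ∧ i • a + j • b + l • e ≤ w} := by
  intro p
  rw [span_monomial_pow, mem_ideal_span_monomial_image]
  refine forall₂_congr fun w _ => ⟨?_, ?_⟩
  · rintro ⟨_, ⟨i, j, l, hn, rfl⟩, h⟩
    exact ⟨i, j, l, hn, h⟩
  · rintro ⟨i, j, l, hn, h⟩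
    exact ⟨_, ⟨i, j, l, hn, rfl⟩, h⟩

end Powers

/-! ### Exponent vectors in four variables. -/

section FourVariables

/-- The exponent vector `(p, q, r, s)` of the monomial `x^p y^q z^r u^s`. -/
noncomputable def expo (p q r s : ℕ) : Fin 4 →₀ ℕ := Finsupp.equivFunOnFinite.symm ![p, q, r, s]

@[simp] theorem expo_zero (p q r s : ℕ) : expo p q r s 0 = p := rfl
@[simp] theorem expo_one (p q r s : ℕ) : expo p q r s 1 = q := rfl
@[simp] theorem expo_two (p q r s : ℕ) : expo p q r s 2 = r := rfl
@[simp] theorem expo_three (p q r s : ℕ) : expo p q r s 3 = s := rfl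

theorem expo_le_iff {a w : Fin 4 →₀ ℕ} :
    a ≤ w ↔ a 0 ≤ w 0 ∧ a 1 ≤ w 1 ∧ a 2 ≤ w 2 ∧ a 3 ≤ w 3 := by
  rw [Finsupp.le_def]
  constructor
  · intro h
    exact ⟨h 0, h 1, h 2, h 3⟩
  · rintro ⟨h0, h1, h2, h3⟩ i
    fin_cases i <;> assumption

theorem monomial_expo {k : Type*} [Field k] (p q r s : ℕ) :
    monomial (expo p q r s) (1 : k) = X 0 ^ p * X 1 ^ q * X 2 ^ r * X 3 ^ s := by
  rw [monomial_eq, map_one, one_mul, Finsupp.prod_fintype _ _ (by simp), Fin.prod_univ_four]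
  simp

/-- The set of exponent vectors whose coordinates satisfy `Q`. -/
def expoSet (Q : ℕ → ℕ → ℕ → ℕ → Prop) : Set (Fin 4 →₀ ℕ) := {w | Q (w 0) (w 1) (w 2) (w 3)}

/-- Reduces colon computations to statements about four natural numbers, within reach of linear
arithmetic. -/
theorem hasColonVars_expoSet_iff {Q : ℕ → ℕ → ℕ → ℕ → Prop} {S : Set (Fin 4)} :
    HasColonVars (expoSet Q) S ↔ ∃ p q r s, (0 ∈ S → Q (p + 1) q r s) ∧
      (1 ∈ S → Q p (q + 1) r s) ∧ (2 ∈ S → Q p q (r + 1) s) ∧ (3 ∈ S → Q p q r (s + 1)) ∧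
      ∀ a b d e, (0 ∈ S → a = 0) → (1 ∈ S → b = 0) → (2 ∈ S → d = 0) → (3 ∈ S → e = 0) →
        ¬ Q (p + a) (q + b) (r + d) (s + e) := by
  constructor
  · rintro ⟨w, hS, hb⟩
    refine ⟨w 0, w 1, w 2, w 3, fun h => ?_, fun h => ?_, fun h => ?_, fun h => ?_,
      fun a b d e ha hb' hd he => ?_⟩
    · simpa [expoSet] using hS 0 h
    · simpa [expoSet] using hS 1 h
    · simpa [expoSet] using hS 2 h
    · simpa [expoSet] using hS 3 h
    · have := hb (expo a b d e) (fun i hi => by fin_cases i <;> simp_all)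
      simpa [expoSet] using this
  · rintro ⟨p, q, r, s, h0, h1, h2, h3, hb⟩
    refine ⟨expo p q r s, fun i hi => ?_, fun b hbS => ?_⟩
    · fin_cases i
      · simpa [expoSet] using h0 hi
      · simpa [expoSet] using h1 hi
      · simpa [expoSet] using h2 hi
      · simpa [expoSet] using h3 hi
    · have := hb (b 0) (b 1) (b 2) (b 3) (hbS 0) (hbS 1) (hbS 2) (hbS 3)
      simpa [expoSet] using this

/-- Used to see that a linear form avoids every associated prime that does not contain all the
variables occurring in it. -/
theorem mem_span_X_image_linear {k : Type*} [Field k] {S : Set (Fin 4)} {f : MvPolynomial (Fin 4) k}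
    (hf : f ∈ Ideal.span (X '' S)) {i : Fin 4} (hi : f.coeff (Finsupp.single i 1) ≠ 0) : i ∈ S := by
  rw [mem_ideal_span_X_image] at hf
  obtain ⟨j, hj, hne⟩ := hf _ (mem_support_iff.2 hi)
  rw [Finsupp.single_apply] at hne
  split_ifs at hne with h
  · exact h ▸ hj
  · exact absurd rfl hne

theorem idealOfVars_ne_top {σ k : Type*} [Field k] : idealOfVars σ k ≠ ⊤ := by
  rw [idealOfVars, ← Set.image_univ]
  exact (isPrime_span_X_image Set.univ).ne_top

end FourVariables

/-! ### Exponent arithmetic for the powers of `I`. -/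

section ArithI

/-- Coordinates of the monomials in the `n`-th power of
`(x^(d+2) z^(d+1), u^(2d+1) y z, u^(2d+3))`. -/
def MemI (d n p q r s : ℕ) : Prop :=
  ∃ i N, i + N = n ∧ (d + 2) * i ≤ p ∧ (d + 1) * i ≤ r ∧ (2 * d + 3) * N ≤ s + 2 * q ∧
    (2 * d + 3) * N + (2 * d + 2) * i ≤ s + 2 * r ∧ (2 * d + 1) * N ≤ s

/-- With `N = j + l` fixed, a larger `j` lowers the required power of `u` by 2 each time, so the
best `j` is `min(N, q, r - (d+1) i)`. The three lower bounds on `s` in `MemI` correspond to the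
three entries of this minimum. -/
theorem memI_iff (d n p q r s : ℕ) : MemI d n p q r s ↔
    ∃ i j l, i + j + l = n ∧ (d + 2) * i ≤ p ∧ j ≤ q ∧ (d + 1) * i + j ≤ r ∧
      (2 * d + 1) * j + (2 * d + 3) * l ≤ s := by
  constructor
  · rintro ⟨i, N, rfl, h1, h2, h3, h4, h5⟩
    have hmin : ∃ j ≤ N, j ≤ q ∧ (d + 1) * i + j ≤ r ∧ (2 * d + 3) * N ≤ s + 2 * j := by
      rcases le_total N q with hq | hq
      · rcases le_total ((d + 1) * i + N) r with hr | hr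
        · exact ⟨N, le_rfl, hq, hr, by nlinarith⟩
        · exact ⟨r - (d + 1) * i, by omega, by omega, by omega, by
            have : r - (d + 1) * i + (d + 1) * i = r := by omega
            nlinarith⟩
      · rcases le_total ((d + 1) * i + q) r with hr | hr
        · exact ⟨q, hq, le_rfl, hr, h3⟩
        · exact ⟨r - (d + 1) * i, by omega, by omega, by omega, by
            have : r - (d + 1) * i + (d + 1) * i = r := by omega
            nlinarith⟩
    obtain ⟨j, hjN, hjq, hjr, hjs⟩ := hmin
    obtain ⟨l, rfl⟩ := Nat.exists_eq_add_of_le hjN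
    exact ⟨i, j, l, by omega, h1, hjq, hjr, by nlinarith⟩
  · rintro ⟨i, j, l, rfl, h1, h2, h3, h4⟩
    exact ⟨i, j + l, by omega, h1, by nlinarith, by nlinarith, by nlinarith, by nlinarith⟩

/-- Trading a unit of `N` for a unit of `i` only weakens the bounds involving `s`, so a
representation can be pushed up to the largest `i` that `p` might allow. -/
theorem MemI.step {d n p q r s i : ℕ} (h : MemI d n p q r s) (hi : p < (d + 2) * (i + 1))
    (hin : i ≤ n) : ∃ N, i + N = n ∧ (2 * d + 3) * N ≤ s + 2 * q ∧
    (2 * d + 3) * N + (2 * d + 2) * i ≤ s + 2 * r ∧ (2 * d + 1) * N ≤ s := by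
  obtain ⟨i', N', rfl, h1, h2, h3, h4, h5⟩ := h
  have hle : i' ≤ i := by
    have : i' < i + 1 := lt_of_mul_lt_mul_left (h1.trans_lt hi) (Nat.zero_le _)
    omega
  obtain ⟨t, rfl⟩ := Nat.exists_eq_add_of_le hle
  obtain ⟨N, rfl⟩ := Nat.exists_eq_add_of_le (show t ≤ N' by omega)
  exact ⟨N, by omega, by nlinarith, by nlinarith, by nlinarith⟩

/-- If multiplication by `x` moves a monomial into the ideal, it does so through the generators
with exactly one more factor `x^(d+2) z^(d+1)` than the monomial admits. -/
theorem MemI.of_succ {d n p q r s : ℕ} (h : MemI d n (p + 1) q r s) (hn : ¬ MemI d n p q r s) :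
    ∃ i N, i + 1 + N = n ∧ p + 1 = (d + 2) * (i + 1) ∧ (d + 1) * (i + 1) ≤ r ∧
      (2 * d + 3) * N + (2 * d + 2) * (i + 1) ≤ s + 2 * r := by
  obtain ⟨i, N, hiN, h1, h2, h3, h4, h5⟩ := h
  have hp : p + 1 = (d + 2) * i := by
    by_contra hne
    exact hn ⟨i, N, hiN, by omega, h2, h3, h4, h5⟩
  rcases i with _ | i
  · omega
  · exact ⟨i, N, hiN, hp, h2, h4⟩

/-- The `x`-step fixes the extremal `i`. At that `i`, the `z`-step supplies the bound not involving
`r`, and the `y`-step the bounds not involving `q`. -/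
theorem memI_of_xyz {d n p q r s : ℕ} (hx : MemI d n (p + 1) q r s)
    (hy : MemI d n p (q + 1) r s) (hz : MemI d n p q (r + 1) s) : MemI d n p q r s := by
  by_contra hn
  obtain ⟨i, N, hiN, hp, hr, -⟩ := hx.of_succ hn
  obtain ⟨N₁, h1, -, hy2, hy3⟩ := hy.step (i := i) (by omega) (by omega)
  obtain ⟨N₂, h2, hz1, -, -⟩ := hz.step (i := i) (by omega) (by omega)
  obtain rfl : N₁ = N₂ := by omega
  exact hn ⟨i, N₁, h1, by nlinarith, by nlinarith, hz1, hy2, hy3⟩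

/-- At the extremal `i`, only the bound on `s + 2r` can fail. Since `r ≥ (d+1)(i+1)` and `s ≥
(2d+1)(N+1)`, its failure forces `d + 1 < N + 1`. -/
theorem lt_of_memI_xz {d n p q r s : ℕ} (hx : MemI d n (p + 1) q r s)
    (hz : MemI d n p q (r + 1) s) (hn : ¬ MemI d n p q r s) : d + 1 < n := by
  obtain ⟨i, N, hiN, hp, hr, hs⟩ := hx.of_succ hn
  obtain ⟨N₂, h2, hz1, hz2, hz3⟩ := hz.step (i := i) (by omega) (by omega)
  obtain rfl : N₂ = N + 1 := by omega
  have : ¬ (2 * d + 3) * (N + 1) + (2 * d + 2) * i ≤ s + 2 * r := fun h =>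
    hn ⟨i, N + 1, h2, by nlinarith, by nlinarith, hz1, h, hz3⟩
  nlinarith

/-- For `d = 0` the generators are `x^2 z`, `uyz`, `u^3`. Once `x` is free, each `z` is better spent
on `x^2 z`, and the middle generator becomes unnecessary. -/
theorem memI_of_y_of_eq_zero {n p q r s : ℕ} (hy : MemI 0 n p (q + 1) r s) :
    MemI 0 n (p + 2 * n) q r s := by
  obtain ⟨i, N, rfl, h1, h2, h3, h4, h5⟩ := hy
  rcases le_total (i + N) r with h | h
  · exact ⟨i + N, 0, by omega, by omega, by omega, by omega, by omega, by omega⟩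
  · exact ⟨r, i + N - r, by omega, by omega, by omega, by omega, by omega, by omega⟩

theorem HasColonVars.of_memI {d n : ℕ} {S : Set (Fin 4)}
    (h : HasColonVars (expoSet (MemI d n)) S) :
    3 ∈ S ∧ (0 ∈ S ∨ 2 ∈ S) ∧ ¬(0 ∈ S ∧ 1 ∈ S ∧ 2 ∈ S) ∧ (d = 0 → ¬(0 ∉ S ∧ 1 ∈ S)) := by
  obtain ⟨p, q, r, s, h0, h1, h2, h3, hb⟩ := hasColonVars_expoSet_iff.1 h
  refine ⟨?_, ?_, ?_, ?_⟩
  · by_contra hS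
    refine hb 0 0 0 ((2 * d + 3) * n) (by simp) (by simp) (by simp) (fun h => absurd h hS) ?_
    exact ⟨0, n, by omega, by omega, by omega, by nlinarith, by nlinarith, by nlinarith⟩
  · by_contra hS
    push Not at hS
    refine hb ((d + 2) * n) 0 ((d + 1) * n) 0 (fun h => absurd h hS.1) (by simp)
      (fun h => absurd h hS.2) (by simp) ?_
    exact ⟨n, 0, by omega, by omega, by omega, by omega, by nlinarith, by omega⟩
  · rintro ⟨hS0, hS1, hS2⟩
    exact hb 0 0 0 0 (by simp) (by simp) (by simp) (by simp)
      (memI_of_xyz (h0 hS0) (h1 hS1) (h2 hS2))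
  · rintro rfl ⟨hS0, hS1⟩
    exact hb (2 * n) 0 0 0 (fun h => absurd h hS0) (by simp) (by simp) (by simp)
      (memI_of_y_of_eq_zero (h1 hS1))

theorem lt_of_hasColonVars_memI {d n : ℕ} {S : Set (Fin 4)} (h0S : 0 ∈ S) (h2S : 2 ∈ S)
    (h : HasColonVars (expoSet (MemI d n)) S) : d + 1 < n := by
  obtain ⟨p, q, r, s, h0, -, h2, -, hb⟩ := hasColonVars_expoSet_iff.1 h
  exact lt_of_memI_xz (h0 h0S) (h2 h2S) (hb 0 0 0 0 (by simp) (by simp) (by simp) (by simp))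

theorem hasColonVars_memI_of_xyu {d n : ℕ} (hn : 1 ≤ n) {S : Set (Fin 4)} (h0 : 0 ∈ S)
    (h1 : 1 ∈ S) (h2 : 2 ∉ S) (h3 : 3 ∈ S) : HasColonVars (expoSet (MemI d n)) S := by
  obtain ⟨n, rfl⟩ := Nat.exists_eq_add_of_le' hn
  refine hasColonVars_expoSet_iff.2
    -- The power of `x` is one short of `n + 1` first generators, and with `n` of them used,
    -- `u^(2d+2)` is one `y` short of the second generator and one `u` short of the third.
    ⟨(d + 2) * n + d + 1, 0, (2 * d + 3) * (n + 1), 2 * d + 2, fun _ => ?_, fun _ => ?_,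
      fun h => absurd h h2, fun _ => ?_, fun a b e f ha hb _ hf => ?_⟩
  · exact ⟨n + 1, 0, by omega, by nlinarith, by nlinarith, by omega, by nlinarith, by omega⟩
  · exact ⟨n, 1, by omega, by omega, by nlinarith, by omega, by nlinarith, by omega⟩
  · exact ⟨n, 1, by omega, by omega, by nlinarith, by omega, by nlinarith, by omega⟩
  · obtain rfl := ha h0
    obtain rfl := hb h1
    obtain rfl := hf h3
    rintro ⟨i, N, hiN, m1, m2, m3, m4, m5⟩
    have : i < n + 1 := lt_of_mul_lt_mul_left (a := d + 2) (by nlinarith) (Nat.zero_le _)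
    nlinarith

theorem hasColonVars_memI_of_xu {d n : ℕ} (hn : 1 ≤ n) {S : Set (Fin 4)} (h0 : 0 ∈ S)
    (h1 : 1 ∉ S) (h2 : 2 ∉ S) (h3 : 3 ∈ S) : HasColonVars (expoSet (MemI d n)) S := by
  obtain ⟨n, rfl⟩ := Nat.exists_eq_add_of_le' hn
  refine hasColonVars_expoSet_iff.2
    ⟨(d + 2) * n + d + 1, 2 * d + 3, (2 * d + 3) * (n + 1), 2 * d, fun _ => ?_,
      fun h => absurd h h1, fun h => absurd h h2, fun _ => ?_, fun a b e f ha _ _ hf => ?_⟩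
  · exact ⟨n + 1, 0, by omega, by nlinarith, by nlinarith, by omega, by nlinarith, by omega⟩
  · exact ⟨n, 1, by omega, by omega, by nlinarith, by omega, by nlinarith, by omega⟩
  · obtain rfl := ha h0
    obtain rfl := hf h3
    rintro ⟨i, N, hiN, m1, m2, m3, m4, m5⟩
    have : i < n + 1 := lt_of_mul_lt_mul_left (a := d + 2) (by nlinarith) (Nat.zero_le _)
    nlinarith

theorem hasColonVars_memI_of_zu {d n : ℕ} (hn : 1 ≤ n) {S : Set (Fin 4)} (h0 : 0 ∉ S)
    (h1 : 1 ∉ S) (h2 : 2 ∈ S) (h3 : 3 ∈ S) : HasColonVars (expoSet (MemI d n)) S := by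
  obtain ⟨n, rfl⟩ := Nat.exists_eq_add_of_le' hn
  -- `t = max(2, 2d)`: in general `u^(2d)` is one short of `u^(2d+1) y z`, but for `d = 0` no `z`
  -- remains after `n` first generators, and only `u^3` can complete the product.
  obtain ⟨t, ht1, ht2, ht3⟩ : ∃ t, 2 * d ≤ t ∧ 2 ≤ t ∧ (t ≤ 2 ∨ t ≤ 2 * d) := by
    rcases le_total d 1 with h | h
    · exact ⟨2, by omega, by omega, by omega⟩
    · exact ⟨2 * d, by omega, by omega, by omega⟩
  refine hasColonVars_expoSet_iff.2
    ⟨(d + 2) * (n + 1), 2 * d + 3, (d + 1) * n + d, t, fun h => absurd h h0,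
      fun h => absurd h h1, fun _ => ?_, fun _ => ?_, fun a b e f _ _ he hf => ?_⟩
  · exact ⟨n + 1, 0, by omega, by nlinarith, by nlinarith, by omega, by nlinarith, by omega⟩
  · exact ⟨n, 1, by omega, by nlinarith, by nlinarith, by omega, by nlinarith, by omega⟩
  · obtain rfl := he h2
    obtain rfl := hf h3
    rintro ⟨i, N, hiN, m1, m2, m3, m4, m5⟩
    have hi : i < n + 1 := lt_of_mul_lt_mul_left (a := d + 1) (by nlinarith) (Nat.zero_le _)
    rcases ht3 with ht | ht
    · obtain ⟨e, rfl⟩ := Nat.exists_eq_add_of_le (show i ≤ n by omega)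
      obtain rfl : N = e + 1 := by omega
      nlinarith
    · nlinarith

theorem hasColonVars_memI_of_xzu {d n : ℕ} (hn : d + 2 ≤ n) {S : Set (Fin 4)} (h0 : 0 ∈ S)
    (h1 : 1 ∉ S) (h2 : 2 ∈ S) (h3 : 3 ∈ S) : HasColonVars (expoSet (MemI d n)) S := by
  obtain ⟨n, rfl⟩ := Nat.exists_eq_add_of_le' (show 1 ≤ n by omega)
  refine hasColonVars_expoSet_iff.2
    -- Here `s + 2r` is one short of `(2d+3)(n+1)`, and `x^(d+1)` excludes the first generator. The
    -- remaining bound `(2d+1)(n+1) ≤ (2d+3) n` is where `n + 1 ≥ d + 2` enters.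
    ⟨d + 1, 2 * d + 3, d + 1, (2 * d + 3) * n, fun _ => ?_,
      fun h => absurd h h1, fun _ => ?_, fun _ => ?_, fun a b e f ha _ he hf => ?_⟩
  · exact ⟨1, n, by omega, by omega, by omega, by omega, by omega, by nlinarith⟩
  · exact ⟨0, n + 1, by omega, by omega, by omega, by nlinarith, by nlinarith, by nlinarith⟩
  · exact ⟨0, n + 1, by omega, by omega, by omega, by nlinarith, by nlinarith, by nlinarith⟩
  · obtain rfl := ha h0
    obtain rfl := he h2
    obtain rfl := hf h3
    rintro ⟨i, N, hiN, m1, m2, m3, m4, m5⟩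
    have hi : i < 1 := lt_of_mul_lt_mul_left (a := d + 2) (by omega) (Nat.zero_le _)
    obtain rfl : i = 0 := by omega
    obtain rfl : N = n + 1 := by omega
    nlinarith

theorem hasColonVars_memI_of_yzu {d n : ℕ} (hd : 1 ≤ d) (hn : 1 ≤ n) {S : Set (Fin 4)}
    (h0 : 0 ∉ S) (h1 : 1 ∈ S) (h2 : 2 ∈ S) (h3 : 3 ∈ S) :
    HasColonVars (expoSet (MemI d n)) S := by
  obtain ⟨n, rfl⟩ := Nat.exists_eq_add_of_le' hn
  refine hasColonVars_expoSet_iff.2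
    ⟨(d + 2) * (n + 1), 0, (d + 1) * n + d, 2 * d + 2, fun h => absurd h h0,
      fun _ => ?_, fun _ => ?_, fun _ => ?_, fun a b e f _ hb he hf => ?_⟩
  · exact ⟨n, 1, by omega, by nlinarith, by nlinarith, by omega, by nlinarith, by omega⟩
  · exact ⟨n + 1, 0, by omega, by nlinarith, by nlinarith, by omega, by nlinarith, by omega⟩
  · exact ⟨n, 1, by omega, by nlinarith, by nlinarith, by omega, by nlinarith, by omega⟩
  · obtain rfl := hb h1
    obtain rfl := he h2
    obtain rfl := hf h3
    rintro ⟨i, N, hiN, m1, m2, m3, m4, m5⟩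
    have hi : i < n + 1 := lt_of_mul_lt_mul_left (a := d + 1) (by nlinarith) (Nat.zero_le _)
    nlinarith

theorem hasColonVars_memI_iff {d n : ℕ} (hn : d + 2 ≤ n) (S : Set (Fin 4)) :
    HasColonVars (expoSet (MemI d n)) S ↔ 3 ∈ S ∧ (0 ∈ S ∨ 2 ∈ S) ∧ ¬(0 ∈ S ∧ 1 ∈ S ∧ 2 ∈ S) ∧
      (d = 0 → ¬(0 ∉ S ∧ 1 ∈ S)) := by
  refine ⟨HasColonVars.of_memI, ?_⟩
  rintro ⟨h3, h02, h012, hd⟩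
  have hn1 : 1 ≤ n := by omega
  by_cases h0 : 0 ∈ S <;> by_cases h1 : 1 ∈ S <;> by_cases h2 : 2 ∈ S
  · exact absurd ⟨h0, h1, h2⟩ h012
  · exact hasColonVars_memI_of_xyu hn1 h0 h1 h2 h3
  · exact hasColonVars_memI_of_xzu hn h0 h1 h2 h3
  · exact hasColonVars_memI_of_xu hn1 h0 h1 h2 h3
  · exact hasColonVars_memI_of_yzu (Nat.one_le_iff_ne_zero.2 fun hd0 => hd hd0 ⟨h0, h1⟩)
      hn1 h0 h1 h2 h3
  · exact absurd h02 (by simp [h0, h2])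
  · exact hasColonVars_memI_of_zu hn1 h0 h1 h2 h3
  · exact absurd h02 (by simp [h0, h2])

end ArithI

/-! ### Associated primes and depth for the powers of `I`. -/

section IdealI

variable (k : Type*) [Field k]

theorem idealI_eq (d : ℕ) : idealI k (d + 1) = Ideal.span {monomial (expo (d + 2) 0 (d + 1) 0) 1,
    monomial (expo 0 1 1 (2 * d + 1)) 1, monomial (expo 0 0 0 (2 * d + 3)) 1} := by
  simp only [monomial_expo, idealI, pow_zero, pow_one, mul_one, one_mul]
  rw [show 2 * (d + 1) - 1 = 2 * d + 1 by omega, show 2 * (d + 1) + 1 = 2 * d + 3 by ring,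
    show X 1 * X 2 * X 3 ^ (2 * d + 1) = (X 3 ^ (2 * d + 1) * X 1 * X 2 :
      MvPolynomial (Fin 4) k) by ring]

theorem isMonomialWith_idealI_pow (d n : ℕ) :
    IsMonomialWith (idealI k (d + 1) ^ n) (expoSet (MemI d n)) := by
  rw [idealI_eq]
  convert isMonomialWith_span_pow (k := k) (expo (d + 2) 0 (d + 1) 0) (expo 0 1 1 (2 * d + 1))
    (expo 0 0 0 (2 * d + 3)) n using 1
  ext w
  simp only [expoSet, Set.mem_ofPred_eq, memI_iff]
  refine exists_congr fun i => exists_congr fun j => exists_congr fun l => and_congr_right' ?_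
  rw [expo_le_iff]
  simp only [Finsupp.add_apply, Finsupp.smul_apply, expo_zero, expo_one, expo_two, expo_three,
    smul_eq_mul, mul_zero, add_zero, zero_add, mul_one, mul_comm]

theorem isAstab_idealI (d : ℕ) : IsAstab (idealI k (d + 1)) (d + 2) := by
  refine ⟨⟨by omega, fun n hn => ?_⟩, fun a ⟨ha, h⟩ => ?_⟩
  · rw [associatedPrimes_eq_iff (isMonomialWith_idealI_pow k d n)
      (isMonomialWith_idealI_pow k d (d + 2))]
    intro S
    rw [hasColonVars_memI_iff hn, hasColonVars_memI_iff le_rfl]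
  · by_contra hlt
    have heq := (h (d + 2) (by omega)).trans (h (d + 1) (by omega)).symm
    rw [associatedPrimes_eq_iff (isMonomialWith_idealI_pow k d (d + 2))
      (isMonomialWith_idealI_pow k d (d + 1))] at heq
    have hS := (heq {0, 2, 3}).1 (hasColonVars_memI_of_xzu le_rfl (by simp) (by simp) (by simp)
      (by simp))
    exact absurd (lt_of_hasColonVars_memI (by simp) (by simp) hS) (lt_irrefl _)

theorem depth_idealI_pow (d n : ℕ) (hn : 1 ≤ n) :
    depth (idealOfVars (Fin 4) k) (MvPolynomial (Fin 4) k ⧸ idealI k (d + 1) ^ n) = 1 := by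
  have hU := isMonomialWith_idealI_pow k d n
  have hX : ∀ i, (X i : MvPolynomial (Fin 4) k) ∈ idealOfVars (Fin 4) k :=
    fun i => Ideal.subset_span ⟨i, rfl⟩
  set f : MvPolynomial (Fin 4) k := X 0 + X 1 + X 2 + X 3 with hf
  have hreg : IsSMulRegular (MvPolynomial (Fin 4) k ⧸ idealI k (d + 1) ^ n) f := by
    refine isSMulRegular_of_forall_notMem hU fun S hS hfS => hS.of_memI.2.2.1 ?_
    refine ⟨mem_span_X_image_linear hfS ?_, mem_span_X_image_linear hfS ?_,
      mem_span_X_image_linear hfS ?_⟩ <;>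
    simp [hf, coeff_X, Finsupp.single_left_inj]
  have hle : idealI k (d + 1) ^ n ≤ idealOfVars (Fin 4) k := by
    refine (Ideal.pow_le_self (by omega)).trans (Ideal.span_le.2 ?_)
    rintro _ (rfl | rfl | rfl)
    · exact Ideal.mul_mem_right _ _ (Ideal.pow_mem_of_mem _ (hX 0) _ (by omega))
    · exact Ideal.mul_mem_left _ _ (hX 2)
    · exact Ideal.pow_mem_of_mem _ (hX 3) _ (by omega)
  apply le_antisymm
  · refine depth_le_one_of_mem_associatedPrimes idealOfVars_ne_top hreg
      ((mem_associatedPrimes_iff hU _).2 ⟨{0, 1, 3}, hasColonVars_memI_of_xyu hn (by simp)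
        (by simp) (by simp) (by simp), rfl⟩) ?_
    have hPX : ∀ i ∈ ({0, 1, 3} : Set (Fin 4)), (X i : MvPolynomial (Fin 4) k) ∈
        Ideal.span (X '' {0, 1, 3}) ⊔ Ideal.span {f} :=
      fun i hi => Ideal.mem_sup_left (X_mem_span_X_image.2 hi)
    apply le_antisymm
    · refine sup_le (Ideal.span_mono (Set.image_subset_range _ _)) ?_
      rw [Ideal.span_singleton_le_iff_mem]
      exact add_mem (add_mem (add_mem (hX 0) (hX 1)) (hX 2)) (hX 3)
    · rw [Ideal.span_le]
      rintro _ ⟨i, rfl⟩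
      have h0 := hPX 0 (by simp)
      have h1 := hPX 1 (by simp)
      have h3 := hPX 3 (by simp)
      fin_cases i
      · exact h0
      · exact h1
      · have hfm : f ∈ Ideal.span (X '' {0, 1, 3}) ⊔ Ideal.span {f} :=
          Ideal.mem_sup_right (Ideal.mem_span_singleton_self f)
        have : (X 2 : MvPolynomial (Fin 4) k) = f - X 0 - X 1 - X 3 := by rw [hf]; ring
        change (X 2 : MvPolynomial (Fin 4) k) ∈ _
        rw [this]
        exact sub_mem (sub_mem (sub_mem hfm h0) h1) h3
      · exact h3
  · exact one_le_depth_quotient idealOfVars_ne_top hle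
      (add_mem (add_mem (add_mem (hX 0) (hX 1)) (hX 2)) (hX 3)) hreg

theorem isDstab_idealI (d : ℕ) : IsDstab (idealOfVars (Fin 4) k) (idealI k (d + 1)) 1 := by
  refine ⟨⟨le_rfl, fun n hn => ?_⟩, fun a ha => ha.1⟩
  rw [depth_idealI_pow k d n hn, depth_idealI_pow k d 1 le_rfl]

end IdealI

/-! ### Exponent arithmetic for the powers of `J` and of its specialization `K`. -/

section ArithJ

/-- Coordinates of the monomials in the `n`-th power of
`(x^(d+2) y^(d+1), x^(d+1) y^(d+1) z, z^(d+2) u^(d+2))`. -/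
def MemJ (d n p q r s : ℕ) : Prop :=
  (d + 2) * n ≤ p + r ∧ ∃ l N, l + N = n ∧ (d + 1) * N ≤ p ∧ (d + 1) * N ≤ q ∧
    (d + 2) * l ≤ r ∧ (d + 2) * l ≤ s

/-- For fixed `l` and `N = i + j`, a split of `N` exists exactly when the surplus of `x` and the
surplus of `z` add up to at least `N`. The resulting bound on `p + r` depends only on `n`, because
the generators have weights `d+2`, `d+2` and `d+2` in `x` and `z`. -/
theorem memJ_iff (d n p q r s : ℕ) : MemJ d n p q r s ↔
    ∃ i j l, i + j + l = n ∧ (d + 2) * i + (d + 1) * j ≤ p ∧ (d + 1) * i + (d + 1) * j ≤ q ∧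
      j + (d + 2) * l ≤ r ∧ (d + 2) * l ≤ s := by
  constructor
  · rintro ⟨h, l, N, rfl, h1, h2, h3, h4⟩
    rcases le_total (N + (d + 2) * l) r with hr | hr
    · exact ⟨0, N, l, by omega, by omega, by omega, by omega, h4⟩
    · obtain ⟨i, hi⟩ := Nat.exists_eq_add_of_le hr
      obtain ⟨j, rfl⟩ := Nat.exists_eq_add_of_le (show i ≤ N by omega)
      exact ⟨i, j, l, by omega, by nlinarith, by nlinarith, by omega, h4⟩
  · rintro ⟨i, j, l, rfl, h1, h2, h3, h4⟩
    exact ⟨by nlinarith, l, i + j, by omega, by nlinarith, by nlinarith, by nlinarith, h4⟩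

/-- The `y`-step gives the bound on `p + r`; the other bounds see only `min(p, q)`, which one of the
two steps leaves unchanged. -/
theorem memJ_of_xy {d n p q r s : ℕ} (hx : MemJ d n (p + 1) q r s)
    (hy : MemJ d n p (q + 1) r s) : MemJ d n p q r s := by
  obtain ⟨-, l, N, rfl, h1, h2, h3, h4⟩ := hx
  obtain ⟨h, l', N', hn, h1', h2', h3', h4'⟩ := hy
  refine ⟨h, ?_⟩
  rcases le_total p q with hpq | hpq
  · exact ⟨l', N', hn, h1', h1'.trans hpq, h3', h4'⟩
  · exact ⟨l, N, rfl, h2.trans hpq, h2, h3, h4⟩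

theorem memJ_of_zu {d n p q r s : ℕ} (hz : MemJ d n p q (r + 1) s)
    (hu : MemJ d n p q r (s + 1)) : MemJ d n p q r s := by
  obtain ⟨-, l, N, rfl, h1, h2, h3, h4⟩ := hz
  obtain ⟨h, l', N', hn, h1', h2', h3', h4'⟩ := hu
  refine ⟨h, ?_⟩
  rcases le_total r s with hrs | hrs
  · exact ⟨l', N', hn, h1', h2', h3', h3'.trans hrs⟩
  · exact ⟨l, N, rfl, h1, h2, h4.trans hrs, h4⟩

theorem hasColonVars_memJ_iff {d n : ℕ} (hn : 1 ≤ n) (S : Set (Fin 4)) :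
    HasColonVars (expoSet (MemJ d n)) S ↔
      (0 ∈ S ∨ 1 ∈ S) ∧ (2 ∈ S ∨ 3 ∈ S) ∧ ¬(0 ∈ S ∧ 1 ∈ S) ∧ ¬(2 ∈ S ∧ 3 ∈ S) := by
  rw [hasColonVars_expoSet_iff]
  constructor
  · rintro ⟨p, q, r, s, h0, h1, h2, h3, hb⟩
    have hw : ¬ MemJ d n p q r s := hb 0 0 0 0 (by simp) (by simp) (by simp) (by simp)
    refine ⟨?_, ?_, fun h => hw (memJ_of_xy (h0 h.1) (h1 h.2)),
      fun h => hw (memJ_of_zu (h2 h.1) (h3 h.2))⟩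
    · by_contra hS
      push Not at hS
      refine hb ((d + 2) * n) ((d + 2) * n) 0 0 (fun h => absurd h hS.1)
        (fun h => absurd h hS.2) (by simp) (by simp) ?_
      exact ⟨by omega, 0, n, by omega, by nlinarith, by nlinarith, by omega, by omega⟩
    · by_contra hS
      push Not at hS
      refine hb 0 0 ((d + 2) * n) ((d + 2) * n) (by simp) (by simp) (fun h => absurd h hS.1)
        (fun h => absurd h hS.2) ?_
      exact ⟨by omega, n, 0, by omega, by omega, by omega, by omega, by omega⟩
  · rintro ⟨h01, h23, hn01, hn23⟩
    obtain ⟨n, rfl⟩ := Nat.exists_eq_add_of_le' hn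
    -- For `(x, z)` the witness has `p + r` one short of the bound. In the other three cases it is
    -- one short of `N = n + 1` and one short of `l = 1`, so `N ≤ n` and `l = 0` cannot reach the
    -- total.
    by_cases h0 : 0 ∈ S <;> by_cases h2 : 2 ∈ S
    · have h1 : 1 ∉ S := fun h => hn01 ⟨h0, h⟩
      have h3 : 3 ∉ S := fun h => hn23 ⟨h2, h⟩
      refine ⟨(d + 1) * (n + 1), (d + 1) * (n + 1), n, 0, fun _ => ?_, fun h => absurd h h1,
        fun _ => ?_, fun h => absurd h h3, fun a b e f ha _ he _ => ?_⟩
      · exact ⟨by nlinarith, 0, n + 1, by omega, by omega, by omega, by omega, by omega⟩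
      · exact ⟨by nlinarith, 0, n + 1, by omega, by omega, by omega, by omega, by omega⟩
      · rintro ⟨h, -⟩
        rw [ha h0, he h2] at h
        nlinarith
    · have h1 : 1 ∉ S := fun h => hn01 ⟨h0, h⟩
      have h3 : 3 ∈ S := h23.resolve_left h2
      refine ⟨(d + 1) * n + d, (d + 1) * (n + 1), (d + 2) * (n + 1), d + 1, fun _ => ?_,
        fun h => absurd h h1, fun h => absurd h h2, fun _ => ?_, fun a b e f ha _ _ hf => ?_⟩
      · exact ⟨by nlinarith, 0, n + 1, by omega, by nlinarith, by omega, by omega, by omega⟩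
      · exact ⟨by nlinarith, 1, n, by omega, by nlinarith, by nlinarith, by nlinarith, by omega⟩
      · rw [ha h0, hf h3]
        rintro ⟨-, l, N, hlN, m1, -, -, m4⟩
        have : N < n + 1 := lt_of_mul_lt_mul_left (a := d + 1) (by nlinarith) (Nat.zero_le _)
        nlinarith
    · have h1 : 1 ∈ S := h01.resolve_left h0
      have h3 : 3 ∉ S := fun h => hn23 ⟨h2, h⟩
      refine ⟨(d + 2) * (n + 1), (d + 1) * n + d, d + 1, (d + 2) * (n + 1), fun h => absurd h h0,
        fun _ => ?_, fun _ => ?_, fun h => absurd h h3, fun a b e f _ hb he _ => ?_⟩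
      · exact ⟨by nlinarith, 0, n + 1, by omega, by nlinarith, by nlinarith, by omega, by omega⟩
      · exact ⟨by nlinarith, 1, n, by omega, by nlinarith, by nlinarith, by omega, by nlinarith⟩
      · rw [hb h1, he h2]
        rintro ⟨-, l, N, hlN, -, m2, m3, -⟩
        have : N < n + 1 := lt_of_mul_lt_mul_left (a := d + 1) (by nlinarith) (Nat.zero_le _)
        nlinarith
    · have h1 : 1 ∈ S := h01.resolve_left h0
      have h3 : 3 ∈ S := h23.resolve_left h2
      refine ⟨(d + 2) * (n + 1), (d + 1) * n + d, (d + 2) * (n + 1), d + 1, fun h => absurd h h0,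
        fun _ => ?_, fun h => absurd h h2, fun _ => ?_, fun a b e f _ hb _ hf => ?_⟩
      · exact ⟨by nlinarith, 0, n + 1, by omega, by nlinarith, by nlinarith, by omega, by omega⟩
      · exact ⟨by nlinarith, 1, n, by omega, by nlinarith, by nlinarith, by nlinarith, by omega⟩
      · rw [hb h1, hf h3]
        rintro ⟨-, l, N, hlN, -, m2, -, m4⟩
        have : N < n + 1 := lt_of_mul_lt_mul_left (a := d + 1) (by nlinarith) (Nat.zero_le _)
        nlinarith

/-- Coordinates of the monomials in the `n`-th power of
`(x^(2d+3), x^(2d+2) z, z^(d+2) u^(d+2))`. -/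
def MemK (d n p _q r s : ℕ) : Prop :=
  ∃ l N, l + N = n ∧ (2 * d + 2) * N ≤ p ∧ (d + 2) * l ≤ r ∧ (d + 2) * l ≤ s ∧
    (2 * d + 3) * N + (d + 2) * l ≤ p + r

theorem memK_iff (d n p q r s : ℕ) : MemK d n p q r s ↔
    ∃ i j l, i + j + l = n ∧ (2 * d + 3) * i + (2 * d + 2) * j ≤ p ∧
      j + (d + 2) * l ≤ r ∧ (d + 2) * l ≤ s := by
  constructor
  · rintro ⟨l, N, rfl, h1, h2, h3, h4⟩
    rcases le_total (N + (d + 2) * l) r with hr | hr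
    · exact ⟨0, N, l, by omega, by omega, by omega, h3⟩
    · obtain ⟨i, hi⟩ := Nat.exists_eq_add_of_le hr
      obtain ⟨j, rfl⟩ := Nat.exists_eq_add_of_le (show i ≤ N by omega)
      exact ⟨i, j, l, by omega, by nlinarith, by omega, h3⟩
  · rintro ⟨i, j, l, rfl, h1, h2, h3⟩
    exact ⟨l, i + j, by omega, by nlinarith, by nlinarith, by nlinarith, by nlinarith⟩

theorem MemK.step {d n p q r s l : ℕ} (h : MemK d n p q r s) (hl : s < (d + 2) * (l + 1))
    (hln : l ≤ n) : ∃ N, l + N = n ∧ (2 * d + 2) * N ≤ p ∧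
    (2 * d + 3) * N + (d + 2) * l ≤ p + r := by
  obtain ⟨l', N', rfl, h1, h2, h3, h4⟩ := h
  have hle : l' ≤ l := by
    have : l' < l + 1 := lt_of_mul_lt_mul_left (h3.trans_lt hl) (Nat.zero_le _)
    omega
  obtain ⟨t, rfl⟩ := Nat.exists_eq_add_of_le hle
  obtain ⟨N, rfl⟩ := Nat.exists_eq_add_of_le (show t ≤ N' by omega)
  exact ⟨N, by omega, by nlinarith, by nlinarith⟩

/-- The `u`-step needs one more factor `z^(d+2) u^(d+2)`, so `r ≥ (d+2)(l+1)`, while the `z`-step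
gives `p ≥ (2d+2)(N+1)`. Together with failure of the bound on `p + r` at `(l, N+1)`, this forces `N
≥ d + 2`. -/
theorem lt_of_memK_xzu {d n p q r s : ℕ} (hx : MemK d n (p + 1) q r s)
    (hz : MemK d n p q (r + 1) s) (hu : MemK d n p q r (s + 1)) (hn : ¬ MemK d n p q r s) :
    d + 2 < n := by
  obtain ⟨l, N, rfl, h1, h2, h3, h4⟩ := hu
  have hs : s + 1 = (d + 2) * l := by
    by_contra hne
    exact hn ⟨l, N, rfl, h1, h2, by omega, h4⟩
  rcases l with _ | l
  · omega
  obtain ⟨N₁, e1, -, hx2⟩ := hx.step (l := l) (by omega) (by omega)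
  obtain ⟨N₂, e2, hz1, -⟩ := hz.step (l := l) (by omega) (by omega)
  obtain rfl : N₁ = N + 1 := by omega
  obtain rfl : N₂ = N + 1 := by omega
  have : ¬ (2 * d + 3) * (N + 1) + (d + 2) * l ≤ p + r := fun h =>
    hn ⟨l, N + 1, e1, hz1, by nlinarith, by nlinarith, h⟩
  nlinarith

theorem not_hasColonVars_memK {d n : ℕ} (hn : n ≤ d + 2) {S : Set (Fin 4)} (h2S : 2 ∈ S)
    (h3S : 3 ∈ S) : ¬ HasColonVars (expoSet (MemK d n)) S := by
  rw [hasColonVars_expoSet_iff]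
  rintro ⟨p, q, r, s, h0, -, h2, h3, hb⟩
  have h0S : 0 ∈ S := by
    by_contra hS
    refine hb ((2 * d + 3) * n) 0 0 0 (fun h => absurd h hS) (by simp) (by simp) (by simp) ?_
    exact ⟨0, n, by omega, by nlinarith, by omega, by omega, by omega⟩
  have := lt_of_memK_xzu (h0 h0S) (h2 h2S) (h3 h3S)
    (hb 0 0 0 0 (by simp) (by simp) (by simp) (by simp))
  omega

end ArithJ

/-! ### Associated primes and depth for the powers of `J`. -/

section IdealJ

variable (k : Type*) [Field k]

theorem idealJ_eq (d : ℕ) : idealJ k (d + 2) = Ideal.span {monomial (expo (d + 2) (d + 1) 0 0) 1,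
    monomial (expo (d + 1) (d + 1) 1 0) 1, monomial (expo 0 0 (d + 2) (d + 2)) 1} := by
  simp only [monomial_expo, idealJ, pow_zero, pow_one, mul_one, one_mul]
  rfl

theorem isMonomialWith_idealJ_pow (d n : ℕ) :
    IsMonomialWith (idealJ k (d + 2) ^ n) (expoSet (MemJ d n)) := by
  rw [idealJ_eq]
  convert isMonomialWith_span_pow (k := k) (expo (d + 2) (d + 1) 0 0) (expo (d + 1) (d + 1) 1 0)
    (expo 0 0 (d + 2) (d + 2)) n using 1
  ext w
  simp only [expoSet, Set.mem_ofPred_eq, memJ_iff]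
  refine exists_congr fun i => exists_congr fun j => exists_congr fun l => and_congr_right' ?_
  rw [expo_le_iff]
  simp only [Finsupp.add_apply, Finsupp.smul_apply, expo_zero, expo_one, expo_two, expo_three,
    smul_eq_mul, mul_zero, add_zero, zero_add, mul_one, mul_comm]

theorem isAstab_idealJ (d : ℕ) : IsAstab (idealJ k (d + 2)) 1 := by
  refine ⟨⟨le_rfl, fun n hn => ?_⟩, fun a ha => ha.1⟩
  rw [associatedPrimes_eq_iff (isMonomialWith_idealJ_pow k d n) (isMonomialWith_idealJ_pow k d 1)]
  intro S
  rw [hasColonVars_memJ_iff hn, hasColonVars_memJ_iff le_rfl]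

/-- The specialization `y ↦ x`. -/
noncomputable def specializeXY : MvPolynomial (Fin 4) k →ₐ[k] MvPolynomial (Fin 4) k :=
  aeval ![X 0, X 0, X 2, X 3]

@[simp] theorem specializeXY_X (i : Fin 4) :
    specializeXY k (X i) = (![X 0, X 0, X 2, X 3] : Fin 4 → MvPolynomial (Fin 4) k) i :=
  aeval_X _ i

theorem specializeXY_monomial (p q r s : ℕ) : specializeXY k (monomial (expo p q r s) 1) =
    monomial (expo (p + q) 0 r s) 1 := by
  rw [monomial_expo, monomial_expo, map_mul, map_mul, map_mul, map_pow, map_pow, map_pow, map_pow,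
    specializeXY_X, specializeXY_X, specializeXY_X, specializeXY_X, pow_zero, mul_one, pow_add]
  rfl

theorem specializeXY_sub_self_mem (p : MvPolynomial (Fin 4) k) :
    specializeXY k p - p ∈ Ideal.span {(X 0 - X 1 : MvPolynomial (Fin 4) k)} := by
  refine aeval_sub_self_mem (fun i => ?_) p
  fin_cases i
  · simp
  · exact Ideal.mem_span_singleton_self _
  · simp
  · simp

/-- Since `y ↦ x` is the identity modulo `x - y`, working modulo `U + (x - y)` amounts to working
modulo the image ideal, which for powers of `J` is again monomial in the same ring. -/
theorem mem_sup_span_X_sub_X_iff (U : Ideal (MvPolynomial (Fin 4) k))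
    (p : MvPolynomial (Fin 4) k) :
    p ∈ U ⊔ Ideal.span {X 0 - X 1} ↔ specializeXY k p ∈ U.map (specializeXY k) := by
  constructor
  · intro h
    obtain ⟨a, ha, b, hb, rfl⟩ := Submodule.mem_sup.1 h
    obtain ⟨t, rfl⟩ := Ideal.mem_span_singleton'.1 hb
    have : specializeXY k (X 0 - X 1) = 0 := by simp
    rw [map_add, map_mul, this, mul_zero, add_zero]
    exact Ideal.mem_map_of_mem _ ha
  · intro h
    have hle : U.map (specializeXY k) ≤ U ⊔ Ideal.span {X 0 - X 1} := by
      rw [Ideal.map_le_iff_le_comap]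
      intro a ha
      rw [Ideal.mem_comap, ← sub_add_cancel (specializeXY k a) a]
      exact add_mem (Ideal.mem_sup_right (specializeXY_sub_self_mem k a)) (Ideal.mem_sup_left ha)
    rw [← sub_sub_cancel (specializeXY k p) p]
    exact sub_mem (hle h) (Ideal.mem_sup_right (specializeXY_sub_self_mem k p))

theorem isMonomialWith_map_idealJ_pow (d n : ℕ) :
    IsMonomialWith ((idealJ k (d + 2) ^ n).map (specializeXY k)) (expoSet (MemK d n)) := by
  have hmap : (idealJ k (d + 2)).map (specializeXY k) =
      Ideal.span {monomial (expo (2 * d + 3) 0 0 0) 1, monomial (expo (2 * d + 2) 0 1 0) 1,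
        monomial (expo 0 0 (d + 2) (d + 2)) 1} := by
    rw [idealJ_eq, Ideal.map_span]
    simp only [Set.image_insert_eq, Set.image_singleton, specializeXY_monomial]
    rw [show d + 2 + (d + 1) = 2 * d + 3 by ring, show d + 1 + (d + 1) = 2 * d + 2 by ring]
  rw [Ideal.map_pow, hmap]
  convert isMonomialWith_span_pow (k := k) (expo (2 * d + 3) 0 0 0) (expo (2 * d + 2) 0 1 0)
    (expo 0 0 (d + 2) (d + 2)) n using 1
  ext w
  simp only [expoSet, Set.mem_ofPred_eq, memK_iff]
  refine exists_congr fun i => exists_congr fun j => exists_congr fun l => and_congr_right' ?_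
  rw [expo_le_iff]
  simp only [Finsupp.add_apply, Finsupp.smul_apply, expo_zero, expo_one, expo_two, expo_three,
    smul_eq_mul, mul_zero, add_zero, zero_add, mul_one, mul_comm, Nat.zero_le, true_and]

theorem isSMulRegular_X_sub_X_idealJ_pow (d n : ℕ) (hn : 1 ≤ n) :
    IsSMulRegular (MvPolynomial (Fin 4) k ⧸ idealJ k (d + 2) ^ n)
      (X 0 - X 1 : MvPolynomial (Fin 4) k) := by
  refine isSMulRegular_of_forall_notMem (isMonomialWith_idealJ_pow k d n) fun S hS hfS => ?_
  refine ((hasColonVars_memJ_iff hn S).1 hS).2.2.1 ⟨mem_span_X_image_linear hfS ?_,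
    mem_span_X_image_linear hfS ?_⟩ <;>
  simp [coeff_X, Finsupp.single_left_inj]

theorem X_mem_idealOfVars (i : Fin 4) :
    (X i : MvPolynomial (Fin 4) k) ∈ idealOfVars (Fin 4) k := Ideal.subset_span ⟨i, rfl⟩

theorem idealJ_pow_le (d n : ℕ) (hn : 1 ≤ n) :
    idealJ k (d + 2) ^ n ≤ idealOfVars (Fin 4) k := by
  refine (Ideal.pow_le_self (by omega)).trans (Ideal.span_le.2 ?_)
  rintro _ (rfl | rfl | rfl)
  · exact Ideal.mul_mem_right _ _ (Ideal.pow_mem_of_mem _ (X_mem_idealOfVars k 0) _ (by omega))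
  · exact Ideal.mul_mem_left _ _ (X_mem_idealOfVars k 2)
  · exact Ideal.mul_mem_left _ _ (Ideal.pow_mem_of_mem _ (X_mem_idealOfVars k 3) _ (by omega))

theorem two_le_depth_idealJ_pow (d n : ℕ) (hn : 1 ≤ n) (hnd : n ≤ d + 2) :
    2 ≤ depth (idealOfVars (Fin 4) k) (MvPolynomial (Fin 4) k ⧸ idealJ k (d + 2) ^ n) := by
  refine two_le_depth_quotient (g := X 2 - X 3) idealOfVars_ne_top (idealJ_pow_le k d n hn)
    (sub_mem (X_mem_idealOfVars k 0) (X_mem_idealOfVars k 1))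
    (sub_mem (X_mem_idealOfVars k 2) (X_mem_idealOfVars k 3))
    (isSMulRegular_X_sub_X_idealJ_pow k d n hn) fun p hp => ?_
  rw [mem_sup_span_X_sub_X_iff] at hp ⊢
  have hreg : IsSMulRegular
      (MvPolynomial (Fin 4) k ⧸ (idealJ k (d + 2) ^ n).map (specializeXY k))
      (X 2 - X 3 : MvPolynomial (Fin 4) k) := by
    refine isSMulRegular_of_forall_notMem (isMonomialWith_map_idealJ_pow k d n)
      fun S hS hfS => not_hasColonVars_memK hnd (mem_span_X_image_linear hfS ?_)
        (mem_span_X_image_linear hfS ?_) hS <;>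
    simp [coeff_X, Finsupp.single_left_inj]
  refine isSMulRegular_quotient_iff.1 hreg _ ?_
  have : specializeXY k (X 2 - X 3) = X 2 - X 3 := by simp
  rwa [map_mul, this] at hp

theorem depth_idealJ_pow (d n : ℕ) (hn : d + 3 ≤ n) :
    depth (idealOfVars (Fin 4) k) (MvPolynomial (Fin 4) k ⧸ idealJ k (d + 2) ^ n) = 1 := by
  have hn1 : 1 ≤ n := by omega
  have hreg := isSMulRegular_X_sub_X_idealJ_pow k d n hn1
  refine le_antisymm ?_ (one_le_depth_quotient idealOfVars_ne_top (idealJ_pow_le k d n hn1)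
    (sub_mem (X_mem_idealOfVars k 0) (X_mem_idealOfVars k 1)) hreg)
  have hK := isMonomialWith_map_idealJ_pow k d n
  obtain ⟨n, rfl⟩ := Nat.exists_eq_add_of_le' hn1
  -- `w` is one `x` or `z` short of a product of `n + 1` of the first two generators of `K`, and one
  -- `u` short of using `z^(d+2) u^(d+2)` once. The latter needs `n ≥ d + 2` for the power of `z`.
  set w : MvPolynomial (Fin 4) k := monomial (expo ((2 * d + 2) * (n + 1)) 0 n (d + 1)) 1 with hw
  have hspec : specializeXY k w = w := by
    rw [hw, specializeXY_monomial, add_zero]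
  refine depth_quotient_le_one_of_socle (w := w) hreg ?_ fun r hr => ?_
  · rw [mem_sup_span_X_sub_X_iff, hspec, hw, hK.monomial_mem]
    rintro ⟨l, N, hlN, h1, h2, h3, h4⟩
    simp only [expo_zero, expo_two, expo_three] at h1 h2 h3 h4
    obtain rfl : l = 0 := by
      by_contra hl
      have : 1 ≤ l := by omega
      nlinarith
    obtain rfl : N = n + 1 := by omega
    nlinarith
  · have hx : w * X 0 ∈ (idealJ k (d + 2) ^ (n + 1)).map (specializeXY k) := by
      rw [hw, X, monomial_mul, one_mul, hK.monomial_mem]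
      refine ⟨0, n + 1, by omega, ?_, ?_, ?_, ?_⟩ <;> simp
      nlinarith
    have hz : w * X 2 ∈ (idealJ k (d + 2) ^ (n + 1)).map (specializeXY k) := by
      rw [hw, X, monomial_mul, one_mul, hK.monomial_mem]
      refine ⟨0, n + 1, by omega, ?_, ?_, ?_, ?_⟩ <;> simp
      nlinarith
    have hu : w * X 3 ∈ (idealJ k (d + 2) ^ (n + 1)).map (specializeXY k) := by
      rw [hw, X, monomial_mul, one_mul, hK.monomial_mem]
      refine ⟨1, n, by omega, ?_, ?_, ?_, ?_⟩ <;> simp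
      · omega
      · nlinarith
    refine Submodule.span_induction (p := fun r _ => r * w ∈ _) ?_ ?_ ?_ ?_ hr
    · rintro _ ⟨i, rfl⟩
      rw [mul_comm, mem_sup_span_X_sub_X_iff, map_mul, hspec, specializeXY_X]
      fin_cases i
      · exact hx
      · exact hx
      · exact hz
      · exact hu
    · simp
    · intro a b _ _ ha hb
      rw [add_mul]
      exact add_mem ha hb
    · intro a b _ hb
      rw [smul_eq_mul, mul_assoc]
      exact Ideal.mul_mem_left _ _ hb

theorem isDstab_idealJ (d : ℕ) :
    IsDstab (idealOfVars (Fin 4) k) (idealJ k (d + 2)) (d + 3) := by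
  refine ⟨⟨by omega, fun n hn => ?_⟩, fun a ⟨ha, h⟩ => ?_⟩
  · rw [depth_idealJ_pow k d n hn, depth_idealJ_pow k d _ le_rfl]
  · by_contra hlt
    have heq := (h (d + 3) (by omega)).trans (h (d + 2) (by omega)).symm
    rw [depth_idealJ_pow k d _ le_rfl] at heq
    have := two_le_depth_idealJ_pow k d (d + 2) (by omega) le_rfl
    rw [← heq] at this
    exact absurd this (by decide)

end IdealJ

/-! ### Homogeneity. -/

section Homogeneous

variable (k : Type*) [Field k]

theorem isHomogeneousElem_monomial_one {σ : Type*} (w : σ →₀ ℕ) :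
    SetLike.IsHomogeneousElem (homogeneousSubmodule σ k) (monomial w (1 : k)) :=
  ⟨_, isHomogeneous_monomial 1 rfl⟩

theorem isHomogeneous_idealI (d : ℕ) :
    (idealI k (d + 1)).IsHomogeneous (homogeneousSubmodule (Fin 4) k) := by
  rw [idealI_eq]
  refine Ideal.homogeneous_span _ _ ?_
  rintro _ (rfl | rfl | rfl) <;> exact isHomogeneousElem_monomial_one k _

theorem isHomogeneous_idealJ (d : ℕ) :
    (idealJ k (d + 2)).IsHomogeneous (homogeneousSubmodule (Fin 4) k) := by
  rw [idealJ_eq]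
  refine Ideal.homogeneous_span _ _ ?_
  rintro _ (rfl | rfl | rfl) <;> exact isHomogeneousElem_monomial_one k _

end Homogeneous

end PowerStability

theorem theorem2p3 (k : Type*) [Field k] :
    (∀ c : ℕ, ∃ I J : Ideal (MvPolynomial (Fin 4) k),
      I.IsHomogeneous (MvPolynomial.homogeneousSubmodule (Fin 4) k) ∧
      J.IsHomogeneous (MvPolynomial.homogeneousSubmodule (Fin 4) k) ∧
      (∃ a d : ℕ, PowerStability.IsAstab I a ∧
        PowerStability.IsDstab (MvPolynomial.idealOfVars (Fin 4) k) I d ∧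
        (c : ℤ) ≤ (a : ℤ) - (d : ℤ)) ∧
      (∃ a d : ℕ, PowerStability.IsAstab J a ∧
        PowerStability.IsDstab (MvPolynomial.idealOfVars (Fin 4) k) J d ∧
        (c : ℤ) ≤ (d : ℤ) - (a : ℤ))) ∧
    (∀ c : ℕ, 1 ≤ c →
      PowerStability.IsAstab (PowerStability.idealI k c) (c + 1) ∧
      PowerStability.IsDstab (MvPolynomial.idealOfVars (Fin 4) k)
        (PowerStability.idealI k c) 1) ∧
    (∀ c : ℕ, 2 ≤ c →
      PowerStability.IsAstab (PowerStability.idealJ k c) 1 ∧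
      PowerStability.IsDstab (MvPolynomial.idealOfVars (Fin 4) k)
        (PowerStability.idealJ k c) (c + 1)) := by
  refine ⟨fun c => ⟨PowerStability.idealI k (c + 1), PowerStability.idealJ k (c + 2),
    PowerStability.isHomogeneous_idealI k c, PowerStability.isHomogeneous_idealJ k c,
    ⟨c + 2, 1, PowerStability.isAstab_idealI k c, PowerStability.isDstab_idealI k c,
      by push_cast; omega⟩,
    ⟨1, c + 3, PowerStability.isAstab_idealJ k c, PowerStability.isDstab_idealJ k c,
      by push_cast; omega⟩⟩, fun c hc => ?_, fun c hc => ?_⟩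
  · obtain ⟨d, rfl⟩ := Nat.exists_eq_add_of_le' hc
    exact ⟨PowerStability.isAstab_idealI k d, PowerStability.isDstab_idealI k d⟩
  · obtain ⟨d, rfl⟩ := Nat.exists_eq_add_of_le' hc
    exact ⟨PowerStability.isAstab_idealJ k d, PowerStability.isDstab_idealJ k d⟩
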